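/- Let $\Psi=\Gamma'/\Gamma$ denote the digamma function (with poles at $0,-1,-2,\dots$) and $H_n=\sum_{j=1}^n 1/j$. Let $n\ge 2$ be an integer, $a>0$ a real number and $\varphi\in\mathbb{C}$ such that $\varphi+\frac{a\pi l}{n}\notin\pi\mathbb{Z}$ for $l=1,\dots,n-1$, and put $$S_n(\varphi,a)=\sum_{l=1}^{n-1}\csc\!\left(\varphi+\frac{a\pi l}{n}\right),\qquad S_n=S_n(0,1)=\sum_{l=1}^{n-1}\csc\frac{\pi l}{n}.$$ Then $$S_n(\varphi,a)=\frac{n}{a\pi}\sum_{k=0}^{\infty}(-1)^k\left\{\Psi\!\left(\frac{nk}{a}+n+\frac{n\varphi}{a\pi}\right)-\Psi\!\left(1+\frac{nk}{a}+\frac{n}{a}-\frac{n\varphi}{a\pi}-n\right)-\Psi\!\left(1+\frac{nk}{a}+\frac{n\varphi}{a\pi}\right)+\Psi\!\left(\frac{nk}{a}+\frac{n}{a}-\frac{n\varphi}{a\pi}\right)\right\},$$ the series converging as the limit of its partial sums, provided that none of the arguments of $\Psi$ is a pole. Without this proviso, for every $k\ge 0$ the expression in braces, as a function of $\varphi$ (with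 $n,a,k$ fixed), has at most a removable singularity at the given $\varphi$, and the formula holds with each expression in braces replaced by its limit there. Moreover, for every integer $n\ge2$, $$S_n=\frac{2nH_n}{\pi}-\frac{2(1-\ln 2)}{\pi}+\frac{2n}{\pi}\sum_{k=1}^{\infty}(-1)^k\big\{\Psi(nk+n)-\Psi(nk)\big\},$$ the series again converging as the limit of its partial sums, and $\Psi(nk+n)-\Psi(nk)\sim 1/k$ as $k\to\infty$. -/

import Mathlib

open Filter Topology Asymptotics

/-- The cosecant of a complex number. -/
noncomputable def cosecant (z : ℂ) : ℂ := 1 / Complex.sin z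

/-- The sum of cosecants `S_n(φ, a) = ∑_{l=1}^{n-1} csc (φ + a π l / n)`. -/
noncomputable def cosecantSum (n : ℕ) (φ : ℂ) (a : ℝ) : ℂ :=
  ∑ l ∈ Finset.Ico 1 n, cosecant (φ + a * Real.pi * l / n)

/-- `(φ, a)` is admissible for `S_n`: no summand of `S_n(φ, a)` has a pole. -/
def CosecantAdmissible (n : ℕ) (φ : ℂ) (a : ℝ) : Prop :=
  ∀ l ∈ Finset.Ico 1 n, ∀ k : ℤ, φ + a * Real.pi * l / n ≠ Real.pi * k

/-- The poles of the digamma function: the points `0, -1, -2, …`. -/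
def IsDigammaPole (z : ℂ) : Prop := ∃ m : ℕ, z = -(m : ℂ)

/-- First argument: `n k / a + n + n φ / (a π)`. -/
noncomputable def digammaArg₁ (n : ℕ) (φ : ℂ) (a : ℝ) (k : ℕ) : ℂ :=
  n * k / a + n + n * φ / (a * Real.pi)

/-- Second argument: `1 + n k / a + n / a - n φ / (a π) - n`. -/
noncomputable def digammaArg₂ (n : ℕ) (φ : ℂ) (a : ℝ) (k : ℕ) : ℂ :=
  1 + n * k / a + n / a - n * φ / (a * Real.pi) - n

/-- Third argument: `1 + n k / a + n φ / (a π)`. -/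
noncomputable def digammaArg₃ (n : ℕ) (φ : ℂ) (a : ℝ) (k : ℕ) : ℂ :=
  1 + n * k / a + n * φ / (a * Real.pi)

/-- Fourth argument: `n k / a + n / a - n φ / (a π)`. -/
noncomputable def digammaArg₄ (n : ℕ) (φ : ℂ) (a : ℝ) (k : ℕ) : ℂ :=
  n * k / a + n / a - n * φ / (a * Real.pi)

/-- The combination of four digamma values (meaningful when no argument is a pole). -/
noncomputable def digammaBrace (n : ℕ) (φ : ℂ) (a : ℝ) (k : ℕ) : ℂ :=
  Complex.digamma (digammaArg₁ n φ a k) - Complex.digamma (digammaArg₂ n φ a k)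
    - Complex.digamma (digammaArg₃ n φ a k) + Complex.digamma (digammaArg₄ n φ a k)

/-- None of the digamma values occurring in the series for `S_n(φ, a)` is taken at a pole. -/
def DigammaAdmissible (n : ℕ) (φ : ℂ) (a : ℝ) : Prop :=
  ∀ k : ℕ, ¬ IsDigammaPole (digammaArg₁ n φ a k) ∧ ¬ IsDigammaPole (digammaArg₂ n φ a k) ∧
    ¬ IsDigammaPole (digammaArg₃ n φ a k) ∧ ¬ IsDigammaPole (digammaArg₄ n φ a k)

/-! With x_l = φ/π + a l/n, each cosecant is expanded as π csc(π x_l) = ∑ (-1)^k (1/(k + x_l) + 1/(k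
+ 1 - x_l)), the limit given by `tendsto_sum_cosecant`. For fixed k the denominators are arithmetic
progressions in l of step ±a/n; scaling by n/a makes the step ±1, and the functional equation Ψ(s +
1) = Ψ(s) + 1/s turns each sum over l into a difference of two digamma values
(`digammaBrace_eq_braceSum`). Nothing else about Ψ is needed.

The rational function `braceSum` equals the brace away from the poles of Ψ and is continuous at
every admissible φ, so it supplies the removable limits.

For φ = 0, a = 1 the two halves of the brace coincide. Inserting the missing term 1/(nk) for k ≥ 1
completes the digamma difference, and the inserted terms add up to an alternating harmonic series,
whence ln 2. -/

/-- Partial fractions of the cosecant over the integers, from those of the cotangent through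
`csc z = cot (z / 2) - cot z`. -/
theorem hasSum_alternating_cotTerm {x : ℂ} (hx : x ∈ Complex.integerComplement) :
    HasSum (fun k : ℕ => (-1 : ℂ) ^ (k + 1) * cotTerm x k)
      (Real.pi * cosecant (Real.pi * x) - 1 / x) := by
  have hx2 : x / 2 ∈ Complex.integerComplement := by
    rintro ⟨m, hm⟩
    exact hx ⟨2 * m, by push_cast; rw [hm]; ring⟩
  have h1 := (summable_cotTerm hx).hasSum_iff_tendsto_nat.2 (tendsto_logDeriv_euler_cot_sub hx)
  have h2 := (summable_cotTerm hx2).hasSum_iff_tendsto_nat.2 (tendsto_logDeriv_euler_cot_sub hx2)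
  -- `cotTerm x k` has its poles at ±(k + 1): odd indices carry the even integers, and halving gives
  -- the cotangent series at x/2.
  have hodd : HasSum (fun j : ℕ => cotTerm x (2 * j + 1))
      ((1 / 2) * (Real.pi * Complex.cot (Real.pi * (x / 2)) - 1 / (x / 2))) := by
    refine (h2.mul_left (1 / 2)).congr_fun ?_
    intro j
    have e1 : x - ((2 * j + 1 : ℕ) + 1) = 2 * (x / 2 - (j + 1)) := by push_cast; ring
    have e2 : x + ((2 * j + 1 : ℕ) + 1) = 2 * (x / 2 + (j + 1)) := by push_cast; ring
    simp only [cotTerm]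
    rw [e1, e2, one_div, one_div, one_div, one_div, mul_inv, mul_inv]
    ring
  have heven : HasSum (fun j : ℕ => cotTerm x (2 * j)) (∑' j : ℕ, cotTerm x (2 * j)) :=
    ((summable_cotTerm hx).comp_injective
      (i := fun j : ℕ => 2 * j) (fun a b h => by simpa using h)).hasSum
  have hsplit := (heven.even_add_odd hodd).unique h1
  have hb : HasSum (fun k : ℕ => (-1 : ℂ) ^ (k + 1) * cotTerm x k)
      (-(∑' j : ℕ, cotTerm x (2 * j)) +
        (1 / 2) * (Real.pi * Complex.cot (Real.pi * (x / 2)) - 1 / (x / 2))) := by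
    refine HasSum.even_add_odd ?_ ?_
    · refine heven.neg.congr_fun fun j => ?_
      simp [pow_succ, pow_mul]
    · refine hodd.congr_fun fun j => ?_
      simp [pow_succ, pow_mul]
  convert hb using 1
  have hs : Complex.sin (Real.pi * x) ≠ 0 := sin_pi_mul_ne_zero hx
  have hs2 : Complex.sin (Real.pi * (x / 2)) ≠ 0 := sin_pi_mul_ne_zero hx2
  have hx0 : x ≠ 0 := Complex.integerComplement.ne_zero hx
  have hdouble : (Real.pi : ℂ) * x = 2 * (Real.pi * (x / 2)) := by ring
  have key : cosecant (Real.pi * x) =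
      Complex.cot (Real.pi * (x / 2)) - Complex.cot (Real.pi * x) := by
    rw [cosecant, Complex.cot_eq_cos_div_sin, Complex.cot_eq_cos_div_sin, div_sub_div _ _ hs2 hs,
      div_eq_div_iff hs (mul_ne_zero hs2 hs), hdouble, Complex.sin_two_mul, Complex.cos_two_mul]
    ring
  have hE := eq_sub_of_add_eq hsplit
  rw [hE, key]
  field_simp
  ring

theorem tendsto_one_div_const_add_natCast (c : ℂ) :
    Tendsto (fun k : ℕ => 1 / (c + (k : ℂ))) atTop (𝓝 0) := by
  have h : Tendsto (fun k : ℕ => c + (k : ℂ)) atTop (Bornology.cobounded ℂ) := by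
    refine (tendsto_const_add_cobounded c).comp ?_
    rw [← tendsto_norm_atTop_iff_cobounded]
    simpa using tendsto_natCast_atTop_atTop (R := ℝ)
  simpa only [one_div, Function.comp_def] using tendsto_inv₀_cobounded.comp h

/-- The one-sided expansion of the cosecant, pairing the poles at `-k` and `k + 1`. -/
theorem tendsto_sum_cosecant {x : ℂ} (hx : x ∈ Complex.integerComplement) :
    Tendsto (fun N : ℕ => ∑ k ∈ Finset.range N,
        (-1 : ℂ) ^ k * (1 / (k + x) + 1 / (k + 1 - x))) atTop
      (𝓝 (Real.pi * cosecant (Real.pi * x))) := by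
  -- Regrouping the poles as ±(k + 1) leaves one unpaired term, 1/(N + 1 - x) up to sign, which
  -- tends to 0.
  have hpart (N : ℕ) : ∑ k ∈ Finset.range (N + 1),
      (-1 : ℂ) ^ k * (1 / (k + x) + 1 / (k + 1 - x)) =
      1 / x + ∑ k ∈ Finset.range N, (-1 : ℂ) ^ (k + 1) * cotTerm x k +
        (-1) ^ N * (1 / ((1 - x) + N)) := by
    induction N with
    | zero => simp
    | succ N ih =>
      have e : 1 / (x - ((N : ℂ) + 1)) = -(1 / ((1 - x) + N)) := by
        rw [← one_div_neg_eq_neg_one_div]; congr 1; ring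
      rw [Finset.sum_range_succ, ih, Finset.sum_range_succ, cotTerm, e]
      push_cast
      rw [show (N : ℂ) + 1 + 1 - x = 1 - x + (N + 1) by ring, add_comm ((N : ℂ) + 1) x]
      ring
  rw [← tendsto_add_atTop_iff_nat 1]
  simp_rw [hpart]
  have h0 : Tendsto (fun N : ℕ => (-1 : ℂ) ^ N * (1 / ((1 - x) + N))) atTop (𝓝 0) := by
    rw [tendsto_zero_iff_norm_tendsto_zero]
    simpa using (tendsto_one_div_const_add_natCast (1 - x)).norm
  have := ((hasSum_alternating_cotTerm hx).tendsto_sum_nat.const_add (1 / x)).add h0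
  simpa using this

/-! ### Reduction of the digamma terms to rational functions -/

/-- The digamma function along a progression of step one. -/
theorem digamma_add_natCast {s : ℂ} (hs : ¬ IsDigammaPole s) (m : ℕ) :
    Complex.digamma (s + m) = Complex.digamma s + ∑ j ∈ Finset.range m, 1 / (s + j) := by
  induction m with
  | zero => simp
  | succ m ih =>
    have h (i : ℕ) : s + m ≠ -i := by
      intro h
      exact hs ⟨m + i, by push_cast; linear_combination h⟩
    rw [Finset.sum_range_succ, ← add_assoc, ← ih, Nat.cast_succ, ← add_assoc,
      Complex.digamma_apply_add_one _ h, one_div]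

/-- The rational function to which the combination of digamma values reduces. -/
noncomputable def braceSum (n : ℕ) (φ : ℂ) (a : ℝ) (k : ℕ) : ℂ :=
  ∑ l ∈ Finset.Ico 1 n, (1 / (n * k / a + n * φ / (a * Real.pi) + l) +
    1 / (n * k / a + n / a - n * φ / (a * Real.pi) - l))

/-- The first argument exceeds the third by n - 1, and the fourth exceeds the second by n - 1, so
both differences telescope. The sum starting at the second argument is reversed, since l enters
`braceSum` there with a minus sign. -/
theorem digammaBrace_eq_braceSum {n : ℕ} (hn : 2 ≤ n) {φ : ℂ} {a : ℝ} {k : ℕ}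
    (h2 : ¬ IsDigammaPole (digammaArg₂ n φ a k)) (h3 : ¬ IsDigammaPole (digammaArg₃ n φ a k)) :
    digammaBrace n φ a k = braceSum n φ a k := by
  obtain ⟨m, rfl⟩ : ∃ m, n = m + 1 := ⟨n - 1, by omega⟩
  have e1 : digammaArg₁ (m + 1) φ a k = digammaArg₃ (m + 1) φ a k + m := by
    simp only [digammaArg₁, digammaArg₃]; push_cast; ring
  have e4 : digammaArg₄ (m + 1) φ a k = digammaArg₂ (m + 1) φ a k + m := by
    simp only [digammaArg₄, digammaArg₂]; push_cast; ring
  rw [digammaBrace, e1, e4, digamma_add_natCast h3, digamma_add_natCast h2, braceSum,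
    Finset.sum_add_distrib, Finset.sum_Ico_eq_sum_range, Finset.sum_Ico_eq_sum_range,
    Nat.add_sub_cancel, ← Finset.sum_range_reflect (fun j : ℕ => 1 / (digammaArg₂ _ φ a k + j))]
  have s1 : ∑ j ∈ Finset.range m, 1 / (digammaArg₃ (m + 1) φ a k + j) =
      ∑ j ∈ Finset.range m, 1 / (((m + 1 : ℕ) : ℂ) * k / a + (m + 1 : ℕ) * φ / (a * Real.pi) +
        (1 + j : ℕ)) := by
    refine Finset.sum_congr rfl fun j _ => ?_
    congr 1
    simp only [digammaArg₃]; push_cast; ring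
  have s2 : ∑ j ∈ Finset.range m, 1 / (digammaArg₂ (m + 1) φ a k + (m - 1 - j : ℕ)) =
      ∑ j ∈ Finset.range m, 1 / (((m + 1 : ℕ) : ℂ) * k / a + (m + 1 : ℕ) / a -
        (m + 1 : ℕ) * φ / (a * Real.pi) - (1 + j : ℕ)) := by
    refine Finset.sum_congr rfl fun j hj => ?_
    congr 1
    have hj' := Finset.mem_range.1 hj
    have : ((m - 1 - j : ℕ) : ℂ) = m - 1 - j := by
      rw [Nat.cast_sub (by omega), Nat.cast_sub (by omega), Nat.cast_one]
    rw [this]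
    simp only [digammaArg₂]; push_cast; ring
  rw [s1, s2]
  ring

theorem CosecantAdmissible.mem_integerComplement {n : ℕ} {φ : ℂ} {a : ℝ}
    (h : CosecantAdmissible n φ a) {l : ℕ} (hl : l ∈ Finset.Ico 1 n) :
    φ / Real.pi + a * l / n ∈ Complex.integerComplement := by
  rintro ⟨m, hm⟩
  have hpi : (Real.pi : ℂ) ≠ 0 := by exact_mod_cast Real.pi_ne_zero
  apply h l hl m
  rw [hm]
  field_simp

/-! ### The general expansion and its removable singularities -/

section

variable {n : ℕ} {a : ℝ}

theorem braceSum_eq (hn : 2 ≤ n) (ha : 0 < a) (φ : ℂ) (k : ℕ) :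
    (n : ℂ) / (a * Real.pi) * braceSum n φ a k =
      1 / Real.pi * ∑ l ∈ Finset.Ico 1 n, (1 / (k + (φ / Real.pi + a * l / n)) +
        1 / (k + 1 - (φ / Real.pi + a * l / n))) := by
  have hpi : (Real.pi : ℂ) ≠ 0 := by exact_mod_cast Real.pi_ne_zero
  have ha' : (a : ℂ) ≠ 0 := by exact_mod_cast ha.ne'
  have hn' : (n : ℂ) ≠ 0 := by exact_mod_cast (by omega : n ≠ 0)
  rw [braceSum, Finset.mul_sum, Finset.mul_sum]
  refine Finset.sum_congr rfl fun l _ => ?_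
  have e1 : (n : ℂ) * k / a + n * φ / (a * Real.pi) + l =
      n / a * (k + (φ / Real.pi + a * l / n)) := by field_simp; ring
  have e2 : (n : ℂ) * k / a + n / a - n * φ / (a * Real.pi) - l =
      n / a * (k + 1 - (φ / Real.pi + a * l / n)) := by field_simp; ring
  rw [e1, e2, one_div_mul_eq_div, one_div, one_div, mul_inv, mul_inv]
  field_simp

theorem tendsto_sum_braceSum (hn : 2 ≤ n) (ha : 0 < a) {φ : ℂ} (h : CosecantAdmissible n φ a) :
    Tendsto (fun N : ℕ => (n : ℂ) / (a * Real.pi) *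
      ∑ k ∈ Finset.range N, (-1 : ℂ) ^ k * braceSum n φ a k) atTop (𝓝 (cosecantSum n φ a)) := by
  have hpi : (Real.pi : ℂ) ≠ 0 := by exact_mod_cast Real.pi_ne_zero
  have hlim : Tendsto (fun N : ℕ => 1 / (Real.pi : ℂ) * ∑ l ∈ Finset.Ico 1 n,
      ∑ k ∈ Finset.range N, (-1 : ℂ) ^ k * (1 / (k + (φ / Real.pi + a * l / n)) +
        1 / (k + 1 - (φ / Real.pi + a * l / n)))) atTop
      (𝓝 (1 / Real.pi * ∑ l ∈ Finset.Ico 1 n,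
        Real.pi * cosecant (Real.pi * (φ / Real.pi + a * l / n)))) :=
    (tendsto_finsetSum _ fun l hl => tendsto_sum_cosecant (h.mem_integerComplement hl)).const_mul _
  have hval : 1 / (Real.pi : ℂ) * ∑ l ∈ Finset.Ico 1 n,
        Real.pi * cosecant (Real.pi * (φ / Real.pi + a * l / n)) = cosecantSum n φ a := by
    rw [← Finset.mul_sum, ← mul_assoc, one_div_mul_cancel hpi, one_mul, cosecantSum]
    refine Finset.sum_congr rfl fun l _ => ?_
    congr 1
    field_simp
  rw [hval] at hlim
  refine hlim.congr fun N => ?_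
  rw [Finset.sum_comm, Finset.mul_sum, Finset.mul_sum]
  refine Finset.sum_congr rfl fun k _ => ?_
  rw [mul_left_comm ((n : ℂ) / _), braceSum_eq hn ha, ← Finset.mul_sum]
  ring

theorem eventually_not_isDigammaPole (z : ℂ) :
    ∀ᶠ w in 𝓝[≠] z, ¬ IsDigammaPole w := by
  -- Any set of integers is closed in ℂ, so the integers other than z stay away from z.
  have hc : IsClosed (((↑) : ℤ → ℂ) '' {m | (m : ℂ) ≠ z}) :=
    Complex.isClosedEmbedding_intCast.isClosedMap _ (isClosed_discrete _)
  have hz : ∀ᶠ w in 𝓝 z, w ∉ ((↑) : ℤ → ℂ) '' {m | (m : ℂ) ≠ z} :=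
    hc.isOpen_compl.mem_nhds fun ⟨m, hm, h⟩ => hm h
  filter_upwards [nhdsWithin_le_nhds hz, self_mem_nhdsWithin] with w hw hwz
  rintro ⟨m, rfl⟩
  refine hw ⟨-m, ?_, by push_cast; rfl⟩
  simpa using hwz

/-- The second and third arguments are affine in ψ with slopes ∓n/(aπ) ≠ 0, so they map punctured
neighbourhoods into punctured neighbourhoods. -/
theorem eventually_digammaBrace_eq_braceSum (hn : 2 ≤ n) (ha : 0 < a) (φ : ℂ) (k : ℕ) :
    ∀ᶠ ψ in 𝓝[≠] φ, digammaBrace n ψ a k = braceSum n ψ a k := by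
  have hc : (n : ℂ) / (a * Real.pi) ≠ 0 := by
    refine div_ne_zero (by exact_mod_cast (by omega : n ≠ 0)) (mul_ne_zero ?_ ?_)
    · exact_mod_cast ha.ne'
    · exact_mod_cast Real.pi_ne_zero
  have aux {f : ℂ → ℂ} (hf : Continuous f) (hinj : f.Injective) :
      ∀ᶠ ψ in 𝓝[≠] φ, ¬ IsDigammaPole (f ψ) :=
    (hf.continuousWithinAt.tendsto_nhdsWithin (s := {φ}ᶜ) (t := {f φ}ᶜ)
      fun _ hψ h => hψ (hinj h)).eventually (eventually_not_isDigammaPole (f φ))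
  have h2 := aux (f := fun ψ => digammaArg₂ n ψ a k) (by unfold digammaArg₂; fun_prop) (by
    intro x y h
    simp only [digammaArg₂] at h
    refine mul_left_cancel₀ hc ?_
    linear_combination -h)
  have h3 := aux (f := fun ψ => digammaArg₃ n ψ a k) (by unfold digammaArg₃; fun_prop) (by
    intro x y h
    simp only [digammaArg₃] at h
    refine mul_left_cancel₀ hc ?_
    linear_combination h)
  filter_upwards [h2, h3] with ψ h2 h3 using digammaBrace_eq_braceSum hn h2 h3

/-- A vanishing denominator would put φ + aπl/n at -kπ or (k + 1)π, which admissibility excludes. -/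
theorem continuousAt_braceSum (hn : 2 ≤ n) (ha : 0 < a) {φ : ℂ} (h : CosecantAdmissible n φ a)
    (k : ℕ) : ContinuousAt (fun ψ => braceSum n ψ a k) φ := by
  have ha' : (a : ℂ) ≠ 0 := by exact_mod_cast ha.ne'
  have hn' : (n : ℂ) ≠ 0 := by exact_mod_cast (by omega : n ≠ 0)
  have hpi : (Real.pi : ℂ) ≠ 0 := by exact_mod_cast Real.pi_ne_zero
  unfold braceSum
  refine tendsto_finsetSum _ fun l hl => ?_
  refine Tendsto.add (ContinuousAt.div (by fun_prop) (by fun_prop) fun h0 => ?_)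
    (ContinuousAt.div (by fun_prop) (by fun_prop) fun h0 => ?_)
  · refine h l hl (-k) ?_
    field_simp at h0 ⊢
    push_cast
    linear_combination h0
  · refine h l hl (k + 1) ?_
    field_simp at h0 ⊢
    push_cast
    linear_combination -h0

end

/-! ### The special case φ = 0, a = 1 -/

/-- The alternating harmonic series. -/
theorem tendsto_sum_alternating_harmonic :
    Tendsto (fun N : ℕ => ∑ k ∈ Finset.range N, (-1 : ℝ) ^ k * (1 / ((k : ℝ) + 1))) atTop
      (𝓝 (Real.log 2)) := by
  have hanti : Antitone fun k : ℕ => 1 / ((k : ℝ) + 1) := fun i j hij =>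
    one_div_le_one_div_of_le (by positivity) (by gcongr)
  -- Leibniz's criterion gives a limit; the even partial sums H_{2m} - H_m identify it, as Euler's
  -- constant cancels.
  obtain ⟨L, hL⟩ := hanti.tendsto_alternating_series_of_tendsto_zero
    tendsto_one_div_add_atTop_nhds_zero_nat
  have h2 : Tendsto (fun m : ℕ => 2 * m) atTop atTop :=
    tendsto_id.const_mul_atTop' (by norm_num)
  have hpart (m : ℕ) : ∑ k ∈ Finset.range (2 * m), (-1 : ℝ) ^ k * (1 / ((k : ℝ) + 1)) =
      (harmonic (2 * m) : ℝ) - harmonic m := by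
    induction m with
    | zero => simp
    | succ m ih =>
      rw [mul_add, mul_one, Finset.sum_range_succ, Finset.sum_range_succ, ih, harmonic_succ,
        harmonic_succ, harmonic_succ]
      push_cast
      rw [pow_succ, pow_mul]
      field_simp
      ring
  have hγ := (Real.tendsto_harmonic_sub_log.comp h2).sub Real.tendsto_harmonic_sub_log
  have hlog : Tendsto (fun m : ℕ => (harmonic (2 * m) : ℝ) - harmonic m) atTop
      (𝓝 (Real.log 2)) := by
    have := hγ.add_const (Real.log 2)
    rw [sub_self, zero_add] at this
    refine this.congr' ?_
    filter_upwards [eventually_gt_atTop 0] with m hm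
    have hm' : (m : ℝ) ≠ 0 := by positivity
    simp only [Function.comp_apply]
    push_cast
    rw [Real.log_mul two_ne_zero hm']
    ring
  have := tendsto_nhds_unique (hL.comp h2) (hlog.congr fun m => (hpart m).symm)
  rwa [this] at hL

section

variable {n : ℕ}

theorem cosecantAdmissible_zero_one (n : ℕ) : CosecantAdmissible n 0 1 := by
  intro l hl k h
  obtain ⟨h1, h2⟩ := Finset.mem_Ico.1 hl
  have hpi : (Real.pi : ℂ) ≠ 0 := by exact_mod_cast Real.pi_ne_zero
  have hn' : (n : ℂ) ≠ 0 := by exact_mod_cast (by omega : n ≠ 0)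
  have h3 : (l : ℂ) = k * n := by
    rw [zero_add, Complex.ofReal_one, one_mul, mul_div_assoc] at h
    exact (div_eq_iff hn').1 (mul_left_cancel₀ hpi h)
  have h4 : (l : ℤ) = k * n := by exact_mod_cast h3
  have h5 : 0 < k := by
    by_contra! hk
    nlinarith
  nlinarith

/-- The reflection l ↦ n - l exchanges the two halves. -/
theorem braceSum_zero_one (n k : ℕ) :
    braceSum n 0 1 k = 2 * ∑ l ∈ Finset.Ico 1 n, 1 / ((n : ℂ) * k + l) := by
  rw [braceSum, Finset.sum_add_distrib, two_mul]
  congr 1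
  · simp
  · have hr := Finset.sum_Ico_reflect (fun l : ℕ => 1 / ((n : ℂ) * k + l)) 1 (Nat.le_succ n)
    simp only [Nat.add_sub_cancel_left, Nat.add_sub_cancel] at hr
    rw [← hr]
    refine Finset.sum_congr rfl fun l hl => ?_
    rw [Nat.cast_sub (Finset.mem_Ico.1 hl).2.le]
    congr 1
    push_cast
    ring

theorem digamma_mul_add_sub (hn : 2 ≤ n) {k : ℕ} (hk : 1 ≤ k) :
    Complex.digamma (n * k + n) - Complex.digamma (n * k) =
      ∑ l ∈ Finset.range n, 1 / ((n : ℂ) * k + l) := by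
  rw [digamma_add_natCast, add_sub_cancel_left]
  rintro ⟨m, hm⟩
  have h : ((n * k + m : ℕ) : ℂ) = 0 := by push_cast; linear_combination hm
  have h' := Nat.cast_eq_zero.1 h
  have : 0 < n * k := by positivity
  omega

theorem cosecantSum_zero_one (n : ℕ) :
    cosecantSum n 0 1 = ∑ l ∈ Finset.Ico 1 n, cosecant (Real.pi * l / n) := by
  simp [cosecantSum]

theorem tendsto_sum_digamma_sub (hn : 2 ≤ n) :
    Tendsto
      (fun N : ℕ => 2 * (n : ℂ) * (harmonic n : ℂ) / Real.pi
        - 2 * (1 - (Real.log 2 : ℂ)) / Real.pi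
        + 2 * (n : ℂ) / Real.pi *
          ∑ k ∈ Finset.Icc 1 N, (-1 : ℂ) ^ k *
            (Complex.digamma (n * k + n) - Complex.digamma (n * k)))
      atTop (𝓝 (cosecantSum n 0 1)) := by
  have hn' : (n : ℂ) ≠ 0 := by exact_mod_cast (by omega : n ≠ 0)
  have hpi : (Real.pi : ℂ) ≠ 0 := by exact_mod_cast Real.pi_ne_zero
  have h1 := (tendsto_add_atTop_iff_nat 1).2
    (tendsto_sum_braceSum hn one_pos (cosecantAdmissible_zero_one n))
  have h2 : Tendsto (fun N : ℕ => ((∑ k ∈ Finset.range N,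
      (-1 : ℝ) ^ k * (1 / ((k : ℝ) + 1)) : ℝ) : ℂ)) atTop (𝓝 (Real.log 2 : ℂ)) :=
    (Complex.continuous_ofReal.tendsto _).comp tendsto_sum_alternating_harmonic
  -- Adding this null sequence, the tail of the ln 2 series, makes the two sides agree exactly at
  -- every N; the shift by one sets the k = 0 block apart, which yields H_n - 1/n.
  have h3 := h1.add ((h2.const_sub (Real.log 2 : ℂ)).const_mul (2 / (Real.pi : ℂ)))
  rw [sub_self, mul_zero, add_zero] at h3
  refine h3.congr fun N => ?_
  obtain ⟨m, rfl⟩ : ∃ m, n = m + 1 := ⟨n - 1, by omega⟩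
  induction N with
  | zero =>
    have hH : (harmonic (m + 1) : ℂ) =
        ∑ l ∈ Finset.Ico 1 (m + 1), 1 / (l : ℂ) + 1 / ((m : ℂ) + 1) := by
      rw [Finset.sum_Ico_eq_sum_range, Nat.add_sub_cancel, harmonic_succ, harmonic]
      push_cast
      simp [add_comm]
    simp only [zero_add, Finset.sum_range_one, pow_zero, one_mul, Finset.sum_range_zero,
      braceSum_zero_one, hH]
    push_cast at hn' ⊢
    simp
    field_simp
    ring
  | succ N ih =>
    have hr : ∑ l ∈ Finset.range (m + 1), 1 / (((m + 1 : ℕ) : ℂ) * (N + 1 : ℕ) + l) =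
        1 / (((m + 1 : ℕ) : ℂ) * (N + 1 : ℕ)) +
          ∑ l ∈ Finset.Ico 1 (m + 1), 1 / (((m + 1 : ℕ) : ℂ) * (N + 1 : ℕ) + l) := by
      rw [Finset.range_eq_Ico, Finset.sum_eq_sum_Ico_succ_bot (Nat.succ_pos m)]
      simp
    rw [Finset.sum_range_succ (fun k => (-1 : ℂ) ^ k * braceSum (m + 1) 0 1 k) (N + 1),
      Finset.sum_range_succ (fun k : ℕ => (-1 : ℝ) ^ k * (1 / ((k : ℝ) + 1))) N,
      Finset.sum_Icc_succ_top (by omega), digamma_mul_add_sub hn (by omega), braceSum_zero_one, hr,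
      mul_add (2 * _ / _ : ℂ), ← add_assoc, ← ih]
    have hN : (N : ℂ) + 1 ≠ 0 := by exact_mod_cast N.succ_ne_zero
    push_cast at hn' ⊢
    rw [pow_succ]
    field_simp
    ring

theorem digamma_mul_add_sub_isEquivalent (hn : 2 ≤ n) :
    (fun k : ℕ => Complex.digamma (n * k + n) - Complex.digamma (n * k))
      ~[atTop] (fun k : ℕ => 1 / (k : ℂ)) := by
  have hn' : (n : ℂ) ≠ 0 := by exact_mod_cast (by omega : n ≠ 0)
  have hne : ∀ᶠ k : ℕ in atTop, 1 / (k : ℂ) ≠ 0 := by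
    filter_upwards [eventually_gt_atTop 0] with k hk
    exact one_div_ne_zero (by exact_mod_cast hk.ne')
  rw [isEquivalent_iff_tendsto_one hne]
  -- This is k/(nk + l) rewritten; each of the n terms tends to 1/n.
  have hterm (l : ℕ) : Tendsto (fun k : ℕ => (1 / (n : ℂ)) *
      (1 - (l / n) * (1 / ((l : ℂ) / n + k)))) atTop (𝓝 ((1 / (n : ℂ)) * (1 - (l / n) * 0))) :=
    ((tendsto_one_div_const_add_natCast _).const_mul _ |>.const_sub _).const_mul _
  have hsum := tendsto_finsetSum (Finset.range n) fun l _ => hterm l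
  simp only [mul_zero, sub_zero, mul_one, Finset.sum_const, Finset.card_range, nsmul_eq_mul,
    mul_one_div_cancel hn'] at hsum
  refine hsum.congr' ?_
  filter_upwards [eventually_ge_atTop 1] with k hk
  have hk' : (k : ℂ) ≠ 0 := by exact_mod_cast (by omega : k ≠ 0)
  rw [Pi.div_apply, digamma_mul_add_sub hn hk, div_div_eq_mul_div, div_one, Finset.sum_mul]
  refine Finset.sum_congr rfl fun l _ => ?_
  have h0 : (n : ℂ) * k + l ≠ 0 := by
    have : 0 < n * k := by positivity
    exact_mod_cast (by omega : n * k + l ≠ 0)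
  have h0' : (l : ℂ) / n + k ≠ 0 := by
    intro h
    apply h0
    field_simp at h
    linear_combination h
  have h0'' : (l : ℂ) + n * k ≠ 0 := by rwa [add_comm]
  field_simp
  ring

end

theorem mainTheorem6 (n : ℕ) (hn : 2 ≤ n) :
    -- the expansion of `S_n(φ, a)`
    (∀ (a : ℝ) (φ : ℂ), 0 < a → CosecantAdmissible n φ a →
      -- literally, whenever all the digamma values are finite
      (DigammaAdmissible n φ a →
        Tendsto
          (fun N : ℕ => (n : ℂ) / (a * Real.pi) *
            ∑ k ∈ Finset.range N, (-1 : ℂ) ^ k * digammaBrace n φ a k)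
          atTop (𝓝 (cosecantSum n φ a))) ∧
      -- in general: the singularities at `φ` of the terms are removable, and the expansion holds
      -- with the terms continued to `φ` by their limits
      (∃ T : ℕ → ℂ,
        (∀ k : ℕ, Tendsto (fun ψ : ℂ => digammaBrace n ψ a k) (𝓝[≠] φ) (𝓝 (T k))) ∧
        Tendsto
          (fun N : ℕ => (n : ℂ) / (a * Real.pi) *
            ∑ k ∈ Finset.range N, (-1 : ℂ) ^ k * T k)
          atTop (𝓝 (cosecantSum n φ a)))) ∧
    -- the expansion of `S_n = S_n(0, 1)`
    cosecantSum n 0 1 = ∑ l ∈ Finset.Ico 1 n, cosecant (Real.pi * l / n) ∧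
    Tendsto
      (fun N : ℕ => 2 * (n : ℂ) * (harmonic n : ℂ) / Real.pi
        - 2 * (1 - (Real.log 2 : ℂ)) / Real.pi
        + 2 * (n : ℂ) / Real.pi *
          ∑ k ∈ Finset.Icc 1 N, (-1 : ℂ) ^ k *
            (Complex.digamma (n * k + n) - Complex.digamma (n * k)))
      atTop (𝓝 (∑ l ∈ Finset.Ico 1 n, cosecant (Real.pi * l / n))) ∧
    -- the size of its general term
    (fun k : ℕ => Complex.digamma (n * k + n) - Complex.digamma (n * k))
      ~[atTop] (fun k : ℕ => 1 / (k : ℂ)) := by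
  refine ⟨fun a φ ha h => ⟨fun hd => ?_, fun k => braceSum n φ a k, fun k => ?_,
    tendsto_sum_braceSum hn ha h⟩, cosecantSum_zero_one n, ?_, digamma_mul_add_sub_isEquivalent hn⟩
  · refine (tendsto_sum_braceSum hn ha h).congr fun N => ?_
    congr 1
    refine Finset.sum_congr rfl fun k _ => ?_
    rw [digammaBrace_eq_braceSum hn (hd k).2.1 (hd k).2.2.1]
  · exact ((continuousAt_braceSum hn ha h k).tendsto.mono_left nhdsWithin_le_nhds).congr'
      ((eventually_digammaBrace_eq_braceSum hn ha φ k).mono fun _ h => h.symm)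
  · rw [← cosecantSum_zero_one]
    exact tendsto_sum_digamma_sub hn
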